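/- For integers $n\ge k\ge 1$, let $C_n$ be the $n$-cube, i.e. the graph whose vertices are the bit strings of length $n$, two strings being adjacent if their Hamming distance is $1$, and let $C_{n,k}$ be the subgraph of $C_n$ induced by all vertices that have either $k-1$ or $k$ ones. **Theorem.** Let $n$ and $k$ be integers with $1\le k\le n/2$. The number of spanning trees of $C_{n,k}$ is \[ \frac{(n+1)\,k^{\binom{n}{k}-\binom{n}{k-1}}\prod_{i=1}^{k-1}\bigl((k-i)(i+n-k+1)\bigr)^{\binom{n}{k-i}-\binom{n}{k-i-1}}}{\binom{n}{k}+\binom{n}{k-1}}. \] -/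

import Mathlib

/-- The `n`-cube: vertices are the bit strings of length `n`, and two strings are adjacent when
their Hamming distance is `1`. -/
def cubeGraph (n : ℕ) : SimpleGraph (Fin n → Bool) where
  Adj x y := hammingDist x y = 1
  symm := ⟨fun x y h => by rw [hammingDist_comm]; exact h⟩
  loopless := ⟨fun x h => by simp at h⟩

/-- The number of `1`s in a bit string. -/
def numOnes {n : ℕ} (x : Fin n → Bool) : ℕ :=
  (Finset.univ.filter fun i => x i = true).card

/-- The bit strings of length `n` that have either `k - 1` or `k` ones. -/
def cubeLevels (n k : ℕ) : Set (Fin n → Bool) :=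
  {x | numOnes x + 1 = k ∨ numOnes x = k}

/-- The subgraph of the `n`-cube induced by the strings with `k - 1` or `k` ones. -/
def cubeLevelGraph (n k : ℕ) : SimpleGraph (cubeLevels n k) :=
  (cubeGraph n).induce (cubeLevels n k)

/-- The number of spanning trees of a graph `G`: the trees on the whole vertex set of `G` all of
whose edges are edges of `G`. -/
noncomputable def numSpanningTrees {V : Type*} (G : SimpleGraph V) : ℕ :=
  {T : SimpleGraph V | T ≤ G ∧ T.IsTree}.ncard

/-!
The number of vertices times the number of spanning trees of a graph is the linear coefficient of
`det (X + L)`, where `L` is the Laplacian (`exists_det_X_add_lapMatrix`); for the graph on two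
consecutive levels of the cube this determinant can be factored completely.

The first statement rests on the matrix-tree theorem (`det_lapMatrix_updateRow_single`), proved
without the Cauchy–Binet formula. By multilinearity in the rows, the cofactor of `L` at a root `r`
is a sum over all functions `f` choosing a neighbour of each vertex other than `r`. The summand is
`1` if iterating `f` takes every vertex to `r` (the matrix is then unitriangular) and `0` otherwise
(the vertices that never reach `r` give a kernel vector). The functions of the first kind correspond
to the spanning trees, each edge being directed towards `r` (`numSpanningTrees_eq_card_rooted`).

For the second, let `W j` be the inclusion matrix between the `j`-subsets and the `(j + 1)`-subsets
of an `n`-set. With `k = j + 1`, the matrix `X + L` has the diagonal blocks `X + n - j` and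
`X + j + 1` and the off-diagonal blocks `-W j` and its transpose, so its determinant reduces to the
characteristic polynomial of `W j * (W j)ᵀ` (`det_fromBlocks_scalar`). The commutation relation
`W (j + 1) * (W (j + 1))ᵀ = (W j)ᵀ * W j + (n - 2 * (j + 1))`, together with the fact that `A * B`
and `B * A` have the same characteristic polynomial up to a power of `X`, determines that polynomial
by induction on `j` (`det_scalar_sub_inclusionMatrix_mul_transpose`).
-/

/-! ### The matrix-tree theorem -/

/-- The graph of a self-map `f`: every vertex `v` is joined to `f v` (unless `f v = v`). -/
def mapGraph {V : Type*} (f : V → V) : SimpleGraph V :=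
  SimpleGraph.fromRel fun v w => f v = w

theorem mapGraph_adj_self_apply {V : Type*} {f : V → V} {v : V} (h : f v ≠ v) :
    (mapGraph f).Adj v (f v) := by
  simp [mapGraph, h.symm]

theorem mapGraph_reachable_iterate {V : Type*} (f : V → V) (v : V) (m : ℕ) :
    (mapGraph f).Reachable v (f^[m] v) := by
  induction m generalizing v with
  | zero => rfl
  | succ m ih =>
    rw [Function.iterate_succ_apply]
    refine SimpleGraph.Reachable.trans ?_ (ih (f v))
    by_cases h : f v = v
    · rw [h]
    · exact (mapGraph_adj_self_apply h).reachable

theorem mapGraph_le {V : Type*} {G : SimpleGraph V} {f : V → V} {r : V} (hr : f r = r)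
    (h : ∀ v, v ≠ r → G.Adj v (f v)) : mapGraph f ≤ G := by
  intro a b hab
  rw [mapGraph, SimpleGraph.fromRel_adj] at hab
  obtain ⟨hne, h' | h'⟩ := hab
  · exact h' ▸ h a (fun ha => hne (by rw [← h', ha, hr]))
  · exact h' ▸ (h b (fun hb => hne (by rw [← h', hb, hr]))).symm

theorem mapGraph_connected {V : Type*} {f : V → V} {r : V} (hf : ∀ v, ∃ m, f^[m] v = r) :
    (mapGraph f).Connected := by
  have h : ∀ v, (mapGraph f).Reachable v r := fun v => by
    obtain ⟨m, hm⟩ := hf v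
    exact hm ▸ mapGraph_reachable_iterate f v m
  exact { preconnected := fun v w => (h v).trans (h w).symm, nonempty := ⟨r⟩ }

/-- If iterating `f` takes every vertex to the fixed point `r`, the graph of `f` is connected and
has at most one edge for each vertex other than `r`, so it is a tree. -/
theorem mapGraph_isTree {V : Type*} [Finite V] {f : V → V} {r : V} (hr : f r = r)
    (hf : ∀ v, ∃ m, f^[m] v = r) : (mapGraph f).IsTree := by
  classical
  have := Fintype.ofFinite V
  have hc := mapGraph_connected hf
  refine SimpleGraph.isTree_iff_connected_and_card.2 ⟨hc, le_antisymm ?_ ?_⟩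
  · have hsub : (mapGraph f).edgeSet ⊆ (fun v => s(v, f v)) '' {v | v ≠ r} := by
      intro e
      induction e with | _ a b => ?_
      rw [SimpleGraph.mem_edgeSet, mapGraph, SimpleGraph.fromRel_adj]
      rintro ⟨hab, h | h⟩
      · exact ⟨a, fun ha => hab (by rw [← h, ha, hr]), by rw [← h]⟩
      · exact ⟨b, fun hb => hab (by rw [← h, hb, hr]), by rw [← h, Sym2.eq_swap]⟩
    have h1 : Nat.card (mapGraph f).edgeSet ≤ Set.ncard {v : V | v ≠ r} :=
      (Set.ncard_le_ncard hsub (Set.toFinite _)).trans (Set.ncard_image_le (Set.toFinite _))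
    have h2 := Set.ncard_add_ncard_compl {v : V | v ≠ r}
    have h3 : {v : V | v ≠ r}ᶜ = {r} := by ext; simp
    rw [h3, Set.ncard_singleton] at h2
    omega
  · exact hc.card_vert_le_card_edgeSet_add_one

/-- The graph determines the map: where `f` and `g` differ at `v`, the edge from `v` to `g v` must
be traversed by `f` in the opposite direction, hence `f` and `g` differ at `g v` too, and the
disagreement propagates along the `g`-orbit of `v` up to the common fixed point `r`. -/
theorem eq_of_mapGraph_eq {V : Type*} {f g : V → V} {r : V} (hfr : f r = r) (hgr : g r = r)
    (hg : ∀ v, ∃ m, g^[m] v = r) (h : mapGraph f = mapGraph g) : f = g := by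
  -- `g` has no two-cycle, since every orbit ends at the fixed point `r`
  have fix : ∀ (p : ℕ) {v : V}, g (g v) = v → g^[p] v = r → v = r := by
    intro p
    induction p using Nat.strong_induction_on with
    | _ p ih =>
      intro v hv hp
      match p, ih, hp with
      | 0, _, hp => exact hp
      | 1, _, hp =>
        have hp' : g v = r := hp
        rw [← hv, hp', hgr]
      | p + 2, ih, hp =>
        rw [Function.iterate_add_apply] at hp
        exact ih p (by omega) hv ((congrArg _ hv.symm).trans hp)
  have step : ∀ v, f v ≠ g v → f (g v) ≠ g (g v) := by
    intro v hv hE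
    have hvr : v ≠ r := by rintro rfl; exact hv (hfr.trans hgr.symm)
    by_cases hgv : g v = v
    · obtain ⟨m, hm⟩ := hg v
      rw [Function.iterate_fixed hgv] at hm
      exact hvr hm
    have hadj := mapGraph_adj_self_apply hgv
    rw [← h, mapGraph, SimpleGraph.fromRel_adj] at hadj
    obtain ⟨-, h1 | h1⟩ := hadj
    · exact hv h1
    · obtain ⟨m, hm⟩ := hg v
      exact hvr (fix m (hE.symm.trans h1) hm)
  have iter : ∀ (m : ℕ) (v : V), f v ≠ g v → f (g^[m] v) ≠ g (g^[m] v) := by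
    intro m
    induction m with
    | zero => exact fun v hv => hv
    | succ m ih => exact fun v hv => ih (g v) (step v hv)
  funext v
  by_contra hv
  obtain ⟨m, hm⟩ := hg v
  have := iter m v hv
  rw [hm] at this
  exact this (hfr.trans hgr.symm)

/-- Every tree is the graph of the map sending each vertex to a neighbour closer to `r`. -/
theorem SimpleGraph.IsTree.exists_mapGraph_eq {V : Type*} {T : SimpleGraph V} (hT : T.IsTree)
    (r : V) : ∃ f : V → V, f r = r ∧ (∀ v, v ≠ r → T.Adj v (f v)) ∧ (∀ v, ∃ m, f^[m] v = r) ∧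
      mapGraph f = T := by
  classical
  have key : ∀ v, v ≠ r → ∃ w, T.Adj v w ∧ T.dist w r < T.dist v r := by
    intro v hv
    obtain ⟨p, hp⟩ := hT.connected.exists_walk_length_eq_dist v r
    cases p with
    | nil => exact absurd rfl hv
    | cons h q =>
      refine ⟨_, h, ?_⟩
      have := SimpleGraph.dist_le q
      rw [SimpleGraph.Walk.length_cons] at hp
      omega
  choose! p hp hpd using key
  let f : V → V := fun v => if v = r then r else p v
  have hfr : f r = r := if_pos rfl
  have hfp : ∀ v, v ≠ r → f v = p v := fun v hv => if_neg hv
  have hit : ∀ (d : ℕ) (v : V), T.dist v r ≤ d → ∃ m, f^[m] v = r := by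
    intro d
    induction d with
    | zero =>
      intro v hv
      exact ⟨0, hT.connected.dist_eq_zero_iff.1 (Nat.le_zero.1 hv)⟩
    | succ d ih =>
      intro v hv
      by_cases h : v = r
      · exact ⟨0, h⟩
      · obtain ⟨m, hm⟩ := ih (f v) (by rw [hfp v h]; have := hpd v h; omega)
        exact ⟨m + 1, hm⟩
  have hf : ∀ v, ∃ m, f^[m] v = r := fun v => hit _ v le_rfl
  have hadj : ∀ v, v ≠ r → T.Adj v (f v) := fun v hv => by rw [hfp v hv]; exact hp v hv
  have hle := mapGraph_le hfr hadj
  refine ⟨f, hfr, hadj, hf, le_antisymm hle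
    ((SimpleGraph.isTree_iff_minimal_connected.1 hT).2 (mapGraph_connected hf) hle)⟩

open Classical in
/-- Rooting spanning trees at `r` identifies them with the choices, for every other vertex, of a
neighbour, such that following the choices always leads to `r`. -/
theorem numSpanningTrees_eq_card_rooted {V : Type*} [Fintype V] (G : SimpleGraph V) (r : V) :
    numSpanningTrees G =
      ((Fintype.piFinset fun v => if v = r then {r} else G.neighborFinset v).filter
        fun f => ∀ v, ∃ m, f^[m] v = r).card := by
  rw [numSpanningTrees, ← Set.ncard_coe_finset]
  symm
  have hmem : ∀ f : V → V, (f ∈ Fintype.piFinset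
      fun v => if v = r then {r} else G.neighborFinset v) ↔
      f r = r ∧ ∀ v, v ≠ r → G.Adj v (f v) := by
    intro f
    rw [Fintype.mem_piFinset]
    constructor
    · intro h
      refine ⟨by simpa using h r, fun v hv => by simpa [hv] using h v⟩
    · rintro ⟨h1, h2⟩ v
      by_cases hv : v = r
      · simp [hv, h1]
      · simpa [hv] using h2 v hv
  refine Set.ncard_congr (fun f _ => mapGraph f) ?_ ?_ ?_
  · intro f hf
    rw [Finset.mem_coe, Finset.mem_filter, hmem] at hf
    obtain ⟨⟨hfr, hadj⟩, hf⟩ := hf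
    exact ⟨mapGraph_le hfr hadj, mapGraph_isTree hfr hf⟩
  · intro f g hf hg h
    rw [Finset.mem_coe, Finset.mem_filter, hmem] at hf hg
    exact eq_of_mapGraph_eq hf.1.1 hg.1.1 hg.2 h
  · rintro T ⟨hTG, hT⟩
    obtain ⟨f, hfr, hadj, hf, hfT⟩ := hT.exists_mapGraph_eq r
    refine ⟨f, ?_, hfT⟩
    rw [Finset.mem_coe, Finset.mem_filter, hmem]
    exact ⟨⟨hfr, fun v hv => hTG (hadj v hv)⟩, hf⟩

/-- The matrix of `1 - P`, where `P` moves every vertex `v ≠ r` to `f v` and kills `r`. -/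
def rootedMapMatrix {V : Type*} [DecidableEq V] (R : Type*) [CommRing R] (r : V) (f : V → V) :
    Matrix V V R :=
  fun v => if v = r then Pi.single r 1 else Pi.single v 1 - Pi.single (f v) 1

/-- When all vertices lead to `r`, ordering them by the number of steps needed makes
`rootedMapMatrix R r f` triangular with ones on the diagonal. -/
theorem det_rootedMapMatrix_of_forall {V : Type*} [Fintype V] [DecidableEq V] (R : Type*)
    [CommRing R] {r : V} {f : V → V} (hf : ∀ v, ∃ m, f^[m] v = r) :
    (rootedMapMatrix R r f).det = 1 := by
  classical
  let b : V → ℕ := fun v => Nat.find (hf v)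
  have hb : ∀ v, v ≠ r → b (f v) < b v := by
    intro v hv
    have hs := Nat.find_spec (hf v)
    change f^[b v] v = r at hs
    cases hn : b v with
    | zero => rw [hn] at hs; exact absurd hs hv
    | succ n =>
      rw [hn] at hs
      exact Nat.lt_succ_of_le (Nat.find_min' (hf (f v)) hs)
  have key : ∀ i j, i ≠ j → b i ≤ b j → rootedMapMatrix R r f i j = 0 := by
    intro i j hij hle
    unfold rootedMapMatrix
    by_cases hi : i = r
    · subst hi
      simp [hij.symm]
    · have : j ≠ f i := by
        rintro rfl
        exact absurd (hb i hi) (not_lt.2 hle)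
      simp [hi, hij.symm, this]
  have htri : (rootedMapMatrix R r f).BlockTriangular (OrderDual.toDual ∘ b) := by
    intro i j hij
    have h : b i < b j := hij
    exact key i j (fun e => by subst e; exact lt_irrefl _ h) h.le
  rw [htri.det]
  refine Finset.prod_eq_one fun a _ => ?_
  convert Matrix.det_one (n := {i // (OrderDual.toDual ∘ b) i = a}) (R := R)
  ext ⟨i, hi⟩ ⟨j, hj⟩
  rw [Matrix.toSquareBlock_def]
  by_cases hij : i = j
  · subst hij
    rw [Matrix.one_apply_eq]
    by_cases hir : i = r
    · subst hir; simp [rootedMapMatrix]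
    · have : i ≠ f i := fun e => by
        have := hb i hir
        rw [← e] at this
        exact lt_irrefl _ this
      simp [rootedMapMatrix, hir, this]
  · rw [Matrix.one_apply_ne (by simpa using hij)]
    have : b i = b j := OrderDual.toDual.injective (hi.trans hj.symm)
    exact key i j hij this.le

/-- When some vertex does not lead to `r`, the indicator of all such vertices is in the kernel. -/
theorem det_rootedMapMatrix_of_not_forall {V : Type*} [Fintype V] [DecidableEq V] (R : Type*)
    [CommRing R] [IsDomain R] {r : V} {f : V → V} (hf : ¬ ∀ v, ∃ m, f^[m] v = r) :
    (rootedMapMatrix R r f).det = 0 := by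
  classical
  rw [← Matrix.exists_mulVec_eq_zero_iff]
  push Not at hf
  obtain ⟨v, hv⟩ := hf
  refine ⟨fun v => if ∀ m, f^[m] v ≠ r then 1 else 0, fun h => ?_, ?_⟩
  · have := congrFun h v
    simp [hv] at this
  · funext w
    rw [Matrix.mulVec]
    by_cases hw : w = r
    · subst hw
      have : ¬ ∀ m, f^[m] w ≠ w := fun h => h 0 rfl
      simp [rootedMapMatrix, this]
    · have : (∀ m, f^[m] w ≠ r) ↔ ∀ m, f^[m] (f w) ≠ r := by
        constructor
        · exact fun h m => h (m + 1)
        · rintro h (_ | m)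
          · exact hw
          · exact h m
      have hrow : rootedMapMatrix R r f w = Pi.single w 1 - Pi.single (f w) 1 := if_neg hw
      change rootedMapMatrix R r f w ⬝ᵥ _ = 0
      rw [hrow, sub_dotProduct, single_one_dotProduct, single_one_dotProduct]
      simp only [this, sub_self]

/-- The matrix-tree theorem: the principal cofactor of the Laplacian at `r` (the determinant after
the row of `r` is replaced by a unit vector) counts spanning trees. Row `v ≠ r` of the Laplacian is
the sum of `e_v - e_w` over the neighbours `w` of `v`, so by multilinearity the cofactor is a sum
over all choices of a neighbour for each `v ≠ r`. -/
theorem det_lapMatrix_updateRow_single {V : Type*} [Fintype V] [DecidableEq V] (R : Type*)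
    [CommRing R] [IsDomain R] (G : SimpleGraph V) [DecidableRel G.Adj] (r : V) :
    ((G.lapMatrix R).updateRow r (Pi.single r 1)).det = (numSpanningTrees G : R) := by
  classical
  let A : V → Finset V := fun v => if v = r then {r} else G.neighborFinset v
  let g : V → V → V → R := fun v w =>
    if v = r then Pi.single r 1 else Pi.single v 1 - Pi.single w 1
  have hM : (G.lapMatrix R).updateRow r (Pi.single r 1) = fun v => ∑ w ∈ A v, g v w := by
    funext v
    by_cases hv : v = r
    · subst hv
      simp [A, g]
    · rw [Matrix.updateRow_ne hv]
      funext j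
      simp only [A, g, if_neg hv, SimpleGraph.lapMatrix, SimpleGraph.degMatrix, Matrix.sub_apply,
        Finset.sum_apply, Pi.sub_apply, Finset.sum_sub_distrib, Finset.sum_const,
        SimpleGraph.card_neighborFinset_eq_degree, Matrix.diagonal_apply,
        SimpleGraph.adjMatrix_apply, Pi.single_apply, nsmul_eq_mul, mul_ite,
        mul_one, mul_zero, eq_comm (a := j)]
      rw [Finset.sum_ite_eq' (G.neighborFinset v) j]
      simp only [SimpleGraph.mem_neighborFinset]
  rw [hM]
  have := (Matrix.detRowAlternating (n := V) (R := R)).toMultilinearMap.map_sum_finset g A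
  refine this.trans ?_
  rw [numSpanningTrees_eq_card_rooted G r, Finset.card_filter, Nat.cast_sum]
  refine Finset.sum_congr (by congr!) fun f _ => ?_
  change (rootedMapMatrix R r f).det = _
  split_ifs with hf
  · rw [det_rootedMapMatrix_of_forall R hf, Nat.cast_one]
  · rw [det_rootedMapMatrix_of_not_forall R hf, Nat.cast_zero]

open Polynomial in
/-- Each of the `|V|` cofactors along row `r` of the Laplacian counts spanning trees, and their sum
is the linear coefficient of `det (X + L)`. -/
theorem exists_det_X_add_lapMatrix {V : Type*} [Fintype V] [DecidableEq V] [Nonempty V]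
    (R : Type*) [CommRing R] [IsDomain R] (G : SimpleGraph V) [DecidableRel G.Adj] :
    ∃ q : R[X], (Matrix.scalar V (X : R[X]) + (G.lapMatrix R).map C).det = X * q ∧
      q.eval 0 = Fintype.card V * (numSpanningTrees G : R) := by
  obtain ⟨r⟩ := ‹Nonempty V›
  set L := G.lapMatrix R with hL
  set A : Matrix V V R[X] := Matrix.scalar V (X : R[X]) + L.map C with hA
  have hrow : ∀ i, ∑ j, L i j = 0 := fun i => by
    have := congrFun (G.lapMatrix_mulVec_const_eq_zero (R := R)) i
    simpa [Matrix.mulVec, dotProduct] using this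
  have hcol : ∀ j, ∑ i, L i j = 0 := fun j => by
    rw [← hrow j]
    exact Finset.sum_congr rfl fun i _ => (G.isSymm_lapMatrix (R := R)).apply j i
  refine ⟨(A.updateRow r 1).det, ?_, ?_⟩
  · -- the sum of all rows of `X + L` is the constant row `X`
    have h := Matrix.det_updateRow_sum A r (fun _ => 1)
    rw [one_smul] at h
    rw [← h, ← Matrix.det_updateRow_smul]
    congr 2
    funext j
    have : ∑ i, C (L i j) = (0 : R[X]) := by rw [← map_sum, hcol, map_zero]
    refine (Finset.sum_apply j _ _).trans ?_
    have hAj : ∀ i, A i j = (if i = j then X else 0) + C (L i j) := fun i => by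
      simp [hA, Matrix.diagonal_apply]
    simp [hAj, Finset.sum_add_distrib, this]
  · -- at `X = 0` expand the row of ones into unit vectors
    have h0 : (A.updateRow r 1).map (evalRingHom (0 : R)) = L.updateRow r 1 := by
      ext i j
      by_cases hi : i = r
      · subst hi; simp
      · simp [Matrix.updateRow_ne hi, hA, Matrix.diagonal_apply, apply_ite (eval (0 : R))]
    have h1 : (L.updateRow r 1).det = ∑ j, (L.updateRow r (Pi.single j 1)).det := by
      have : (1 : V → R) = ∑ j, Pi.single j 1 := by
        funext i; simp [Finset.sum_apply, Pi.single_apply]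
      rw [this]
      exact (Matrix.detRowAlternating (n := V) (R := R)).toMultilinearMap.map_update_sum
        Finset.univ r (fun j => Pi.single j 1) L
    -- the cofactors agree because all rows of `L`, and `e_j - e_r`, annihilate the constant vector
    have h2 : ∀ j, (L.updateRow r (Pi.single j 1)).det = (L.updateRow r (Pi.single r 1)).det := by
      intro j
      have h3 : (L.updateRow r (Pi.single j 1 - Pi.single r 1)).det = 0 := by
        rw [← Matrix.exists_mulVec_eq_zero_iff]
        refine ⟨1, fun h => one_ne_zero (congrFun h r), ?_⟩
        funext i
        by_cases hi : i = r
        · subst hi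
          change (L.updateRow i (Pi.single j 1 - Pi.single i 1)) i ⬝ᵥ 1 = 0
          rw [Matrix.updateRow_self, sub_dotProduct, single_one_dotProduct, single_one_dotProduct]
          simp
        · change (L.updateRow r (Pi.single j 1 - Pi.single r 1)) i ⬝ᵥ 1 = 0
          rw [Matrix.updateRow_ne hi, dotProduct_one, hrow]
      have h4 := Matrix.det_updateRow_add L r (Pi.single j 1 - Pi.single r 1) (Pi.single r 1)
      rw [sub_add_cancel, h3, zero_add] at h4
      exact h4
    rw [← coe_evalRingHom, RingHom.map_det, RingHom.mapMatrix_apply, h0, h1,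
      Finset.sum_congr rfl fun j _ => h2 j, Finset.sum_const, hL, det_lapMatrix_updateRow_single,
      Finset.card_univ, nsmul_eq_mul]

/-! ### The spectrum of the inclusion matrices -/

theorem card_level_filter_subset {n m : ℕ} (A : Finset (Fin n)) :
    (Finset.univ.filter fun t : {s : Finset (Fin n) // s.card = m} => t.1 ⊆ A).card =
      A.card.choose m := by
  rw [← Finset.card_powersetCard, ← Finset.card_map (Function.Embedding.subtype _)]
  congr 1
  ext u
  simp [Finset.mem_powersetCard, and_comm]

theorem card_level_filter_superset {n m : ℕ} (hm : m ≤ n) (A : Finset (Fin n)) :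
    (Finset.univ.filter fun t : {s : Finset (Fin n) // s.card = m} => A ⊆ t.1).card =
      (n - A.card).choose (n - m) := by
  have h := card_level_filter_subset (m := n - m) Aᶜ
  rw [Finset.card_compl, Fintype.card_fin] at h
  rw [← h]
  refine Finset.card_bij'
    (fun t _ => ⟨t.1ᶜ, by rw [Finset.card_compl, Fintype.card_fin, t.2]⟩)
    (fun t _ => ⟨t.1ᶜ, by rw [Finset.card_compl, Fintype.card_fin, t.2]; omega⟩) ?_ ?_ ?_ ?_
  · intro t ht; simpa using ht
  · intro t ht
    simpa [Finset.subset_compl_comm] using ht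
  · intro t _; simp
  · intro t _; simp

/-- The inclusion matrix between the `j`-subsets and the `(j + 1)`-subsets of an `n`-set. -/
def inclusionMatrix (R : Type*) [CommRing R] (n j : ℕ) :
    Matrix {s : Finset (Fin n) // s.card = j} {s : Finset (Fin n) // s.card = j + 1} R :=
  Matrix.of fun s t => if s.1 ⊆ t.1 then 1 else 0

open Matrix in
theorem inclusionMatrix_mul_transpose_apply (R : Type*) [CommRing R] {n j : ℕ} (h : j + 1 ≤ n)
    (s s' : {s : Finset (Fin n) // s.card = j}) :
    (inclusionMatrix R n j * (inclusionMatrix R n j)ᵀ) s s' =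
      ((n - (s.1 ∪ s'.1).card).choose (n - (j + 1)) : ℕ) := by
  rw [← card_level_filter_superset h, Finset.card_filter, Matrix.mul_apply, Nat.cast_sum]
  refine Finset.sum_congr rfl fun t _ => ?_
  simp [inclusionMatrix, Finset.union_subset_iff, ← ite_and, and_comm]

open Matrix in
theorem inclusionMatrix_transpose_mul_apply (R : Type*) [CommRing R] {n j : ℕ}
    (s s' : {s : Finset (Fin n) // s.card = j + 1}) :
    ((inclusionMatrix R n j)ᵀ * inclusionMatrix R n j) s s' =
      ((s.1 ∩ s'.1).card.choose j : ℕ) := by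
  rw [← card_level_filter_subset, Finset.card_filter, Matrix.mul_apply, Nat.cast_sum]
  refine Finset.sum_congr rfl fun t _ => ?_
  simp [inclusionMatrix, Finset.subset_inter_iff, ← ite_and, and_comm]

open Matrix in
/-- The commutation relation between going up and going down in the Boolean lattice: both sides
count the ways of moving from one `(j + 1)`-set to another through an adjacent level, and they
differ only on the diagonal. -/
theorem inclusionMatrix_mul_transpose_succ (R : Type*) [CommRing R] {n j : ℕ} (h : j + 2 ≤ n) :
    inclusionMatrix R n (j + 1) * (inclusionMatrix R n (j + 1))ᵀ =
      (inclusionMatrix R n j)ᵀ * inclusionMatrix R n j +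
        Matrix.scalar _ ((n : R) - 2 * (j + 1)) := by
  ext s s'
  rw [inclusionMatrix_mul_transpose_apply R h, Matrix.add_apply,
    inclusionMatrix_transpose_mul_apply, Matrix.scalar_apply, Matrix.diagonal_apply]
  have hs := s.2
  have hs' := s'.2
  by_cases hss : s = s'
  · subst hss
    obtain ⟨m, rfl⟩ := Nat.exists_eq_add_of_le h
    rw [if_pos rfl, Finset.union_self, Finset.inter_self, s.2, Nat.choose_succ_self_right,
      show j + 2 + m - (j + 1) = m + 1 by omega, show j + 2 + m - (j + 1 + 1) = m by omega,
      Nat.choose_succ_self_right]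
    push_cast
    ring
  · rw [if_neg hss, add_zero]
    have hui := Finset.card_union_add_card_inter s.1 s'.1
    have hun : (s.1 ∪ s'.1).card ≤ n := card_finset_fin_le _
    have hlt : (s.1 ∩ s'.1).card < j + 1 := by
      by_contra hge
      have h1 : s.1 ∩ s'.1 = s.1 := Finset.eq_of_subset_of_card_le Finset.inter_subset_left
        (by omega)
      have h2 : s.1 ∩ s'.1 = s'.1 := Finset.eq_of_subset_of_card_le Finset.inter_subset_right
        (by omega)
      exact hss (Subtype.ext (h1.symm.trans h2))
    congr 1
    rcases Nat.lt_or_ge (s.1 ∩ s'.1).card j with hj | hj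
    · rw [Nat.choose_eq_zero_of_lt hj, Nat.choose_eq_zero_of_lt (by omega)]
    · rw [show (s.1 ∩ s'.1).card = j by omega,
        show n - (s.1 ∪ s'.1).card = n - (j + 1 + 1) by omega, Nat.choose_self, Nat.choose_self]

open Matrix in
/-- The characteristic polynomial of `W Wᵀ`, where `W` is the inclusion matrix from level `j` to
level `j + 1`. Passing from `j` to `j + 1` replaces `W Wᵀ` by `Wᵀ W`, which has the same nonzero
spectrum, and shifts it by a scalar. -/
theorem det_scalar_sub_inclusionMatrix_mul_transpose {R : Type*} [CommRing R] {n j : ℕ}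
    (h1 : j + 1 ≤ n) (h : 2 * j ≤ n) (x : R) :
    (Matrix.scalar _ x - inclusionMatrix R n j * (inclusionMatrix R n j)ᵀ).det =
      (x - (j + 1) * (n - j)) * ∏ i ∈ Finset.range j,
        (x - (i + 1) * (n - 2 * j + i)) ^ (n.choose (j - i) - n.choose (j - i - 1)) := by
  induction j generalizing x with
  | zero =>
    have : Unique {s : Finset (Fin n) // s.card = 0} :=
      { default := ⟨∅, rfl⟩, uniq := fun s => Subtype.ext (Finset.card_eq_zero.1 s.2) }
    rw [Matrix.det_unique, Matrix.sub_apply, inclusionMatrix_mul_transpose_apply R h1,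
      Finset.union_self, (default : {s : Finset (Fin n) // s.card = 0}).2]
    obtain ⟨m, rfl⟩ := Nat.exists_eq_add_of_le' h1
    simp
  | succ j ih =>
    have hle : n.choose j ≤ n.choose (j + 1) := Nat.choose_le_succ_of_lt_half_left (by omega)
    rw [inclusionMatrix_mul_transpose_succ R h1, add_comm (_ * _), ← sub_sub, ← map_sub,
      ← Matrix.eval_charpoly, Matrix.charpoly_mul_comm_of_le _ _ (by
        rw [Fintype.card_finset_len, Fintype.card_finset_len, Fintype.card_fin]; exact hle),
      Polynomial.eval_mul, Matrix.eval_charpoly, ih (by omega) (by omega),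
      Fintype.card_finset_len, Fintype.card_finset_len, Fintype.card_fin,
      Finset.prod_range_succ', Polynomial.eval_pow, Polynomial.eval_X]
    rw [mul_left_comm, mul_comm ((x - _) ^ _)]
    push_cast
    congr 1
    · ring
    congr 1
    · refine Finset.prod_congr rfl fun i _ => ?_
      congr 1
      ring
    · congr 1
      ring

/-! ### Two consecutive levels of the cube -/

open Matrix in
/-- The determinant of a matrix with scalar diagonal blocks in terms of `W Wᵀ`, without inverting
the scalars. -/
theorem det_fromBlocks_scalar {R m n : Type*} [CommRing R] [IsDomain R] [Fintype m] [DecidableEq m]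
    [Fintype n] [DecidableEq n] (W : Matrix m n R) {p q : R} (hp : p ≠ 0)
    (hmn : Fintype.card m ≤ Fintype.card n) :
    (Matrix.fromBlocks (Matrix.scalar m q) (-W) (-Wᵀ) (Matrix.scalar n p)).det =
      p ^ (Fintype.card n - Fintype.card m) * (Matrix.scalar m (q * p) - W * Wᵀ).det := by
  have h : Matrix.fromBlocks (Matrix.scalar m q) (-W) (-Wᵀ) (Matrix.scalar n p) *
      Matrix.fromBlocks (Matrix.scalar m p) 0 Wᵀ 1 =
      Matrix.fromBlocks (Matrix.scalar m (q * p) - W * Wᵀ) (-W) 0 (Matrix.scalar n p) := by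
    rw [Matrix.fromBlocks_multiply]
    congr 1
    · rw [← map_mul, Matrix.neg_mul, sub_eq_add_neg]
    · simp
    · ext i j
      simp [mul_comm]
    · simp
  have hd := congrArg Matrix.det h
  -- compare determinants; the auxiliary factor contributes `p ^ card m`, which is cancelled below
  rw [Matrix.det_mul, Matrix.det_fromBlocks_zero₁₂, Matrix.det_fromBlocks_zero₂₁, Matrix.det_one,
    mul_one, Matrix.scalar_apply, Matrix.scalar_apply, Matrix.scalar_apply, Matrix.det_diagonal,
    Matrix.det_diagonal, Finset.prod_const, Finset.prod_const, Finset.card_univ,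
    Finset.card_univ] at hd
  refine mul_right_cancel₀ (pow_ne_zero (Fintype.card m) hp) ?_
  rw [Matrix.scalar_apply, Matrix.scalar_apply, hd, Matrix.scalar_apply, mul_right_comm, ← pow_add,
    Nat.sub_add_cancel hmn, mul_comm]

/-- Bit strings of length `n` as subsets of `Fin n`. -/
def bitsEquivFinset (n : ℕ) : Finset (Fin n) ≃ (Fin n → Bool) where
  toFun s i := decide (i ∈ s)
  invFun x := Finset.univ.filter fun i => x i = true
  left_inv s := by ext; simp
  right_inv x := by ext; simp

theorem numOnes_bitsEquivFinset {n : ℕ} (s : Finset (Fin n)) :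
    numOnes (bitsEquivFinset n s) = s.card := by
  simp [numOnes, bitsEquivFinset]

/-- The Hamming distance is the size of the symmetric difference. -/
theorem hammingDist_bitsEquivFinset {n : ℕ} (s t : Finset (Fin n)) :
    hammingDist (bitsEquivFinset n s) (bitsEquivFinset n t) = (s \ t).card + (t \ s).card := by
  rw [← Finset.card_union_of_disjoint disjoint_sdiff_sdiff, hammingDist]
  congr 1
  ext i
  by_cases hs : i ∈ s <;> by_cases ht : i ∈ t <;> simp [bitsEquivFinset, hs, ht]

theorem cubeGraph_adj_of_card_eq {n : ℕ} {s t : Finset (Fin n)} (h : s.card = t.card) :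
    ¬ (cubeGraph n).Adj (bitsEquivFinset n s) (bitsEquivFinset n t) := by
  change ¬ hammingDist _ _ = 1
  rw [hammingDist_bitsEquivFinset]
  have h1 := Finset.card_sdiff_add_card_inter s t
  have h2 := Finset.card_sdiff_add_card_inter t s
  rw [Finset.inter_comm] at h2
  omega

theorem cubeGraph_adj_of_card_succ {n : ℕ} {s t : Finset (Fin n)} (h : s.card + 1 = t.card) :
    (cubeGraph n).Adj (bitsEquivFinset n s) (bitsEquivFinset n t) ↔ s ⊆ t := by
  change hammingDist _ _ = 1 ↔ _
  rw [hammingDist_bitsEquivFinset, ← Finset.sdiff_eq_empty_iff_subset, ← Finset.card_eq_zero]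
  have h1 := Finset.card_sdiff_add_card_inter s t
  have h2 := Finset.card_sdiff_add_card_inter t s
  rw [Finset.inter_comm] at h2
  omega

/-- The vertices of the two-level graph, split by level. -/
noncomputable def cubeLevelsEquiv (n j : ℕ) :
    {s : Finset (Fin n) // s.card = j} ⊕ {s : Finset (Fin n) // s.card = j + 1} ≃
      cubeLevels n (j + 1) :=
  Equiv.ofBijective
    (Sum.elim
      (fun s => ⟨bitsEquivFinset n s.1, Or.inl (by rw [numOnes_bitsEquivFinset, s.2])⟩)
      (fun s => ⟨bitsEquivFinset n s.1, Or.inr (by rw [numOnes_bitsEquivFinset, s.2])⟩)) (by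
    constructor
    · rintro (s | s) (t | t) h <;>
        have h' := (bitsEquivFinset n).injective (congrArg Subtype.val h)
      · exact congrArg Sum.inl (Subtype.ext h')
      · have := s.2
        have := t.2
        rw [h'] at *
        omega
      · have := s.2
        have := t.2
        rw [h'] at *
        omega
      · exact congrArg Sum.inr (Subtype.ext h')
    · rintro ⟨x, hx⟩
      obtain ⟨s, rfl⟩ := (bitsEquivFinset n).surjective x
      have hx' := hx
      rw [cubeLevels, Set.mem_ofPred_eq, numOnes_bitsEquivFinset] at hx'
      rcases hx' with h | h
      · exact ⟨Sum.inl ⟨s, Nat.succ_injective h⟩, rfl⟩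
      · exact ⟨Sum.inr ⟨s, h⟩, rfl⟩)

theorem cubeLevelGraph_adj_inl_inl {n j : ℕ} (s t : {s : Finset (Fin n) // s.card = j}) :
    ¬ (cubeLevelGraph n (j + 1)).Adj (cubeLevelsEquiv n j (Sum.inl s))
      (cubeLevelsEquiv n j (Sum.inl t)) :=
  cubeGraph_adj_of_card_eq (s.2.trans t.2.symm)

theorem cubeLevelGraph_adj_inr_inr {n j : ℕ} (s t : {s : Finset (Fin n) // s.card = j + 1}) :
    ¬ (cubeLevelGraph n (j + 1)).Adj (cubeLevelsEquiv n j (Sum.inr s))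
      (cubeLevelsEquiv n j (Sum.inr t)) :=
  cubeGraph_adj_of_card_eq (s.2.trans t.2.symm)

theorem cubeLevelGraph_adj_inl_inr {n j : ℕ} (s : {s : Finset (Fin n) // s.card = j})
    (t : {s : Finset (Fin n) // s.card = j + 1}) :
    (cubeLevelGraph n (j + 1)).Adj (cubeLevelsEquiv n j (Sum.inl s))
      (cubeLevelsEquiv n j (Sum.inr t)) ↔ s.1 ⊆ t.1 :=
  cubeGraph_adj_of_card_succ (by rw [s.2, t.2])

theorem cubeLevelGraph_adj_inr_inl {n j : ℕ} (s : {s : Finset (Fin n) // s.card = j})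
    (t : {s : Finset (Fin n) // s.card = j + 1}) :
    (cubeLevelGraph n (j + 1)).Adj (cubeLevelsEquiv n j (Sum.inr t))
      (cubeLevelsEquiv n j (Sum.inl s)) ↔ s.1 ⊆ t.1 := by
  rw [SimpleGraph.adj_comm, cubeLevelGraph_adj_inl_inr]

theorem degree_cubeLevelsEquiv_inl {n j : ℕ} (h : j + 1 ≤ n) [Fintype (cubeLevels n (j + 1))]
    [DecidableRel (cubeLevelGraph n (j + 1)).Adj] (s : {s : Finset (Fin n) // s.card = j}) :
    (cubeLevelGraph n (j + 1)).degree (cubeLevelsEquiv n j (Sum.inl s)) = n - j := by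
  have hd := (cubeLevelGraph n (j + 1)).degree_eq_sum_if_adj (R := ℕ)
    (cubeLevelsEquiv n j (Sum.inl s))
  rw [← Equiv.sum_comp (cubeLevelsEquiv n j), Fintype.sum_sum_type] at hd
  simp only [cubeLevelGraph_adj_inl_inl, cubeLevelGraph_adj_inl_inr, if_false,
    Finset.sum_const_zero, zero_add, Nat.cast_id] at hd
  rw [hd, ← Finset.card_filter, card_level_filter_superset h, s.2,
    show n - j = n - (j + 1) + 1 by omega, Nat.choose_succ_self_right]

theorem degree_cubeLevelsEquiv_inr {n j : ℕ} [Fintype (cubeLevels n (j + 1))]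
    [DecidableRel (cubeLevelGraph n (j + 1)).Adj] (t : {s : Finset (Fin n) // s.card = j + 1}) :
    (cubeLevelGraph n (j + 1)).degree (cubeLevelsEquiv n j (Sum.inr t)) = j + 1 := by
  have hd := (cubeLevelGraph n (j + 1)).degree_eq_sum_if_adj (R := ℕ)
    (cubeLevelsEquiv n j (Sum.inr t))
  rw [← Equiv.sum_comp (cubeLevelsEquiv n j), Fintype.sum_sum_type] at hd
  simp only [cubeLevelGraph_adj_inr_inr, cubeLevelGraph_adj_inr_inl, if_false,
    Finset.sum_const_zero, add_zero, Nat.cast_id] at hd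
  rw [hd, ← Finset.card_filter, card_level_filter_subset, t.2, Nat.choose_succ_self_right]

open Polynomial Matrix in
theorem X_add_lapMatrix_submatrix_cubeLevelsEquiv (R : Type*) [CommRing R] {n j : ℕ}
    (h : j + 1 ≤ n) [Fintype (cubeLevels n (j + 1))] [DecidableEq (cubeLevels n (j + 1))]
    [DecidableRel (cubeLevelGraph n (j + 1)).Adj] :
    (Matrix.scalar _ (X : R[X]) + ((cubeLevelGraph n (j + 1)).lapMatrix R).map C).submatrix
        (cubeLevelsEquiv n j) (cubeLevelsEquiv n j) =
      Matrix.fromBlocks (Matrix.scalar _ (X + ((n : R[X]) - (j : R[X])))) (-inclusionMatrix R[X] n j)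
        (-(inclusionMatrix R[X] n j)ᵀ) (Matrix.scalar _ (X + ((j : R[X]) + 1))) := by
  have hnj : ((n - j : ℕ) : R[X]) = n - j := Nat.cast_sub (by omega)
  ext1 (s | s) (t | t)
  · by_cases hst : s = t
    · subst hst
      simp [SimpleGraph.lapMatrix, SimpleGraph.degMatrix, degree_cubeLevelsEquiv_inl h, hnj]
    · simp [SimpleGraph.lapMatrix, SimpleGraph.degMatrix, hst,
        cubeLevelGraph_adj_inl_inl]
  · simp [SimpleGraph.lapMatrix, SimpleGraph.degMatrix,
      cubeLevelGraph_adj_inl_inr, inclusionMatrix, apply_ite (C : R → R[X])]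
  · simp [SimpleGraph.lapMatrix, SimpleGraph.degMatrix,
      cubeLevelGraph_adj_inr_inl, inclusionMatrix, apply_ite (C : R → R[X])]
  · by_cases hst : s = t
    · subst hst
      simp [SimpleGraph.lapMatrix, SimpleGraph.degMatrix, degree_cubeLevelsEquiv_inr]
    · simp [SimpleGraph.lapMatrix, SimpleGraph.degMatrix, hst,
        cubeLevelGraph_adj_inr_inr]

open Polynomial in
/-- The count before division by the number of vertices. The factor of the determinant coming from
the constant vectors is `X * (X + n + 1)`; cancelling `X` and setting `X = 0` leaves the product. -/
theorem card_mul_numSpanningTrees_cubeLevelGraph {n j : ℕ} (h : 2 * (j + 1) ≤ n) :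
    ((n.choose (j + 1) : ℚ) + n.choose j) * numSpanningTrees (cubeLevelGraph n (j + 1)) =
      (n + 1) * (j + 1 : ℚ) ^ (n.choose (j + 1) - n.choose j) *
        ∏ i ∈ Finset.range j, (((j : ℚ) - i) * (n - j + i + 1)) ^
          (n.choose (j - i) - n.choose (j - i - 1)) := by
  classical
  have hle : n.choose j ≤ n.choose (j + 1) := Nat.choose_le_succ_of_lt_half_left (by omega)
  have : Nonempty {s : Finset (Fin n) // s.card = j} := by
    rw [← Fintype.card_pos_iff, Fintype.card_finset_len, Fintype.card_fin]
    exact Nat.choose_pos (by omega)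
  have : Nonempty (cubeLevels n (j + 1)) := (cubeLevelsEquiv n j).nonempty_congr.1 inferInstance
  obtain ⟨q, hq, hq0⟩ := exists_det_X_add_lapMatrix ℚ (cubeLevelGraph n (j + 1))
  have hp : (X + ((j : ℚ[X]) + 1)) ≠ 0 := by
    intro h0
    have := congrArg (eval 1) h0
    simp only [eval_add, eval_X, eval_natCast, eval_one, eval_zero] at this
    exact absurd this (by positivity)
  have hX : (X + ((n : ℚ[X]) - (j : ℚ[X]))) * (X + ((j : ℚ[X]) + 1)) -
      ((j : ℚ[X]) + 1) * ((n : ℚ[X]) - (j : ℚ[X])) = X * (X + (n : ℚ[X]) + 1) := by ring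
  rw [← Matrix.det_submatrix_equiv_self (cubeLevelsEquiv n j),
    X_add_lapMatrix_submatrix_cubeLevelsEquiv ℚ (by omega), det_fromBlocks_scalar _ hp (by
      rw [Fintype.card_finset_len, Fintype.card_finset_len, Fintype.card_fin]; exact hle),
    det_scalar_sub_inclusionMatrix_mul_transpose (by omega) (by omega),
    Fintype.card_finset_len, Fintype.card_finset_len, Fintype.card_fin,
    hX, mul_assoc X, mul_left_comm] at hq
  have hq' := congrArg (eval 0) (mul_left_cancel₀ X_ne_zero hq)
  rw [hq0, ← Fintype.card_congr (cubeLevelsEquiv n j), Fintype.card_sum, Fintype.card_finset_len,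
    Fintype.card_finset_len, Fintype.card_fin] at hq'
  push_cast at hq'
  rw [add_comm (n.choose (j + 1) : ℚ), ← hq']
  simp only [eval_mul, eval_pow, eval_add, eval_sub, eval_X, eval_natCast, eval_one, eval_prod,
    eval_ofNat]
  rw [mul_left_comm, ← mul_assoc]
  congr 1
  · ring
  · refine Finset.prod_congr rfl fun i _ => ?_
    congr 1
    ring

theorem mainTheorem9 (n k : ℕ) (hk : 1 ≤ k) (hkn : 2 * k ≤ n) :
    (numSpanningTrees (cubeLevelGraph n k) : ℚ) =
      (((n : ℚ) + 1) * (k : ℚ) ^ ((n.choose k : ℤ) - (n.choose (k - 1) : ℤ)) *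
          ∏ i ∈ Finset.Icc 1 (k - 1),
            (((k : ℚ) - (i : ℚ)) * ((i : ℚ) + (n : ℚ) - (k : ℚ) + 1)) ^
              ((n.choose (k - i) : ℤ) - (n.choose (k - i - 1) : ℤ))) /
        ((n.choose k : ℚ) + (n.choose (k - 1) : ℚ)) := by
  obtain ⟨j, rfl⟩ := Nat.exists_eq_add_of_le' hk
  have hmono : ∀ m, m ≤ j → n.choose m ≤ n.choose (m + 1) := fun m hm =>
    Nat.choose_le_succ_of_lt_half_left (by omega)
  have hpos : 0 < n.choose (j + 1) := Nat.choose_pos (by omega)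
  have hpos' : (0 : ℚ) < n.choose (j + 1) := by exact_mod_cast hpos
  rw [Nat.add_sub_cancel, eq_div_iff (by positivity), mul_comm,
    card_mul_numSpanningTrees_cubeLevelGraph hkn, ← Nat.cast_sub (hmono j le_rfl), zpow_natCast]
  congr 1
  · push_cast; rfl
  rw [← Finset.Ico_add_one_right_eq_Icc, Finset.prod_Ico_eq_prod_range, Nat.add_sub_cancel]
  refine Finset.prod_congr rfl fun i hi => ?_
  rw [Finset.mem_range] at hi
  have hm := hmono (j - i - 1) (by omega)
  rw [show j - i - 1 + 1 = j - i by omega] at hm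
  rw [show j + 1 - (1 + i) = j - i by omega, ← Nat.cast_sub hm, zpow_natCast]
  congr 1
  push_cast
  ring
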